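/- Let $X$ be a Tychonoff space (i.e. completely regular and Hausdorff). A cover $\mathcal C$ of a set is \emph{star-finite} (\emph{star-countable}) if every member of $\mathcal C$ meets at most finitely (countably) many members of $\mathcal C$. For a cover $\mathcal C$ and a set $A$ put $St^0(A,\mathcal C)=A$ and let $St^{m+1}(A,\mathcal C)$ be the union of all members of $\mathcal C$ that meet $St^{m}(A,\mathcal C)$. A metric $d$ induces the uniformity $\mu_d$ consisting of all covers that are refined by $\{B_d(x,\varepsilon):x\in X\}$ for some $\varepsilon>0$; these are the uniform covers. We say that $\mu_d$ has a star-finite (star-countable) base if every uniform cover is refined by a star-finite open uniform cover (by a star-countable uniform cover). The metric $d$ is \emph{Bourbaki-complete} if every filter $\mathcal F$ such that for each $\mathcal U\in\mu_d$ there are $m\in\mathbb N$, $U\in\mathcal U$ and $F\in\mathcal F$ with $F\subset St^m(U,\mathcal U)$ has a cluster point. The space $X$ is \emph{strongly metrizable} if its topology has a base that is the union of countably many star-finite open covers of $X$; it is \emph{\v{C}ech-complete} if it is the intersection of countably many open subsets of its Stone–\v{C}ech compactification $\beta X$. The \emph{cellularity} of $X$ is the supremum of the cardinalities of all partitions of $X$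 into nonempty open sets. Theorem. The following are equivalent: 1. $X$ is metrizable by a Bourbaki-complete metric; 2. $X$ is metrizable by a complete metric $d$ such that $\mu_d$ has a star-finite base; 3. $X$ is homeomorphic to a closed subspace of $D^{\omega_0}\times\mathbb R^{\omega_0}$, where $D$ is a discrete space of cardinality the cellularity of $X$; 4. $X$ is homeomorphic to a closed subspace of a countable product of locally compact metric spaces; 5. $X$ is \v{C}ech-complete and strongly metrizable; 6. $X$ is metrizable by a complete metric $d$ such that $\mu_d$ has a star-countable base. -/

import Mathlib

open Set Filter Topology Uniformity
open scoped Cardinal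

universe u

/-! ### Covers and stars -/

/-- The family `C` of subsets of `X` covers `X`. -/
def IsCover {X : Type u} (C : Set (Set X)) : Prop :=
  ⋃₀ C = univ

/-- `B` refines `C`: every member of `B` lies in a member of `C`. -/
def CoverRefines {X : Type u} (B C : Set (Set X)) : Prop :=
  ∀ U ∈ B, ∃ V ∈ C, U ⊆ V

/-- Every member of `C` meets at most finitely many members of `C`. -/
def IsStarFinite {X : Type u} (C : Set (Set X)) : Prop :=
  ∀ U ∈ C, {V ∈ C | (U ∩ V).Nonempty}.Finite

/-- Every member of `C` meets at most countably many members of `C`. -/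
def IsStarCountable {X : Type u} (C : Set (Set X)) : Prop :=
  ∀ U ∈ C, {V ∈ C | (U ∩ V).Nonempty}.Countable

/-- The star `St(A, C)`: the union of the members of `C` that meet `A`. -/
def coverStar {X : Type u} (C : Set (Set X)) (A : Set X) : Set X :=
  ⋃₀ {V ∈ C | (V ∩ A).Nonempty}

/-- The iterated star: `St⁰(A, C) = A` and `Stᵐ⁺¹(A, C) = St(Stᵐ(A, C), C)`. -/
def iterStar {X : Type u} (C : Set (Set X)) : ℕ → Set X → Set X
  | 0, A => A
  | m + 1, A => coverStar C (iterStar C m A)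

/-! ### Uniform covers and the modifications of a uniformity -/

/-- The uniformity of `X` as a family of covers: `C` is a uniform cover if there is an entourage
`V` such that every ball `V[x]` lies in a member of `C`. -/
def uniformCovers (X : Type u) [UniformSpace X] : Set (Set (Set X)) :=
  {C | ∃ V ∈ 𝓤 X, ∀ x : X, ∃ U ∈ C, UniformSpace.ball x V ⊆ U}

/-- The star-finite modification: the covers refined by a star-finite open uniform cover. -/
def starFiniteModification (X : Type u) [UniformSpace X] : Set (Set (Set X)) :=
  {C | ∃ B ∈ uniformCovers X, IsStarFinite B ∧ (∀ U ∈ B, IsOpen U) ∧ CoverRefines B C}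

/-- The star-countable modification: the covers refined by a star-countable uniform cover. -/
def starCountableModification (X : Type u) [UniformSpace X] : Set (Set (Set X)) :=
  {C | ∃ B ∈ uniformCovers X, IsStarCountable B ∧ CoverRefines B C}

/-! ### Bourbaki-completeness -/

/-- A filter is Bourbaki-Cauchy if for every uniform cover `C` one of its members lies in some
`Stᵐ(U, C)` with `U ∈ C`. -/
def IsBourbakiCauchy {X : Type u} [UniformSpace X] (F : Filter X) : Prop :=
  ∀ C ∈ uniformCovers X, ∃ m : ℕ, ∃ U ∈ C, ∃ S ∈ F, S ⊆ iterStar C m U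

/-- Every (proper) Bourbaki-Cauchy filter has a cluster point. -/
def IsBourbakiComplete (X : Type u) [UniformSpace X] : Prop :=
  ∀ F : Filter X, F.NeBot → IsBourbakiCauchy F → ∃ x : X, ClusterPt x F

/-! ### Topological notions -/

/-- The metric `d` induces the given topology of `X`. -/
def IsCompatibleMetric {X : Type u} [t : TopologicalSpace X] (d : MetricSpace X) : Prop :=
  d.toUniformSpace.toTopologicalSpace = t

/-- The topology has a base that is the union of countably many star-finite open covers. -/
def IsStronglyMetrizable (X : Type u) [TopologicalSpace X] : Prop :=
  ∃ V : ℕ → Set (Set X),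
    (∀ n, IsCover (V n) ∧ IsStarFinite (V n) ∧ ∀ U ∈ V n, IsOpen U) ∧
      TopologicalSpace.IsTopologicalBasis (⋃ n, V n)

/-- `X` is the intersection of countably many open subsets of its Stone-Čech compactification. -/
def IsCechComplete (X : Type u) [TopologicalSpace X] : Prop :=
  ∃ G : ℕ → Set (StoneCech X),
    (∀ n, IsOpen (G n)) ∧ range (stoneCechUnit : X → StoneCech X) = ⋂ n, G n

/-- The supremum of the cardinalities of all partitions of `X` into (nonempty) open sets. -/
noncomputable def cellularity (X : Type u) [TopologicalSpace X] : Cardinal.{u} :=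
  ⨆ P : {P : Set (Set X) // Setoid.IsPartition P ∧ ∀ U ∈ P, IsOpen U}, #(P : Set (Set X))

/-- `X` is homeomorphic to a closed subspace of `Y`. -/
def HomeomorphicToClosedSubspace (X Y : Type*) [TopologicalSpace X] [TopologicalSpace Y] : Prop :=
  ∃ S : Set Y, IsClosed S ∧ Nonempty (X ≃ₜ S)

/-! Condition 5 is the hub: 1, 4 and 6 imply it, and 5 → 3 → 2 → 1 with 2 → 6 and 3 → 4 closes the
circle. Čech-completeness is handled through complete sequences of open covers, so that it can be
tested on ultrafilters of `X`.

The chain components of a star-finite open cover form an open partition, hence number at most the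
cellularity, and each meets only countably many members. So a map into `D` that records the
component, together with countably many Urysohn functions for the members enumerated within each
component, embeds a strongly metrizable space in `D^ω × ℝ^ω`
(`IsStronglyMetrizable.exists_isInducing`). Čech-completeness makes the image closed once
reciprocals of functions vanishing off suitable open sets are added
(`IsCechComplete.exists_isClosedEmbedding`). The product uniformity of `D^ω × ℝ^ω` is complete,
metrizable and has a star-finite base, and closed subspaces inherit all this. Over a star-finite
base, an ultrafilter finer than a Bourbaki-Cauchy filter is Cauchy, which gives 1.

For 1 → 5, annuli in the chain metric of a cover by balls form a star-finite cover
(`exists_annuli`). Bourbaki-completeness forces finite intersections of annuli around a point to be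
covered by finitely many `ε`-balls, and cutting by these balls gives the base. For 6 → 5,
star-countable open covers are refined by star-finite ones. -/

/-! ### Star-finite open covers -/

/-- `C` is a star-finite cover by open sets. -/
def IsStarFiniteOpenCover {X : Type u} [TopologicalSpace X] (C : Set (Set X)) : Prop :=
  IsCover C ∧ IsStarFinite C ∧ ∀ U ∈ C, IsOpen U

theorem IsCover.exists_mem {X : Type u} {C : Set (Set X)} (hC : IsCover C) (x : X) :
    ∃ U ∈ C, x ∈ U := by
  have : x ∈ ⋃₀ C := by rw [hC]; trivial
  simpa using this

theorem isCover_of_forall {X : Type u} {C : Set (Set X)} (h : ∀ x, ∃ U ∈ C, x ∈ U) :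
    IsCover C :=
  eq_univ_of_forall fun x => by simpa using h x

theorem isStarFiniteOpenCover_univ (X : Type u) [TopologicalSpace X] :
    IsStarFiniteOpenCover {(univ : Set X)} := by
  refine ⟨by simp [IsCover], fun U _ => ?_, by simp⟩
  exact (finite_singleton (univ : Set X)).subset fun V hV => hV.1

theorem IsStarFinite.image2_inter {X : Type u} {B C : Set (Set X)} (hB : IsStarFinite B)
    (hC : IsStarFinite C) : IsStarFinite (image2 (· ∩ ·) B C) := by
  rintro _ ⟨U, hU, V, hV, rfl⟩
  refine ((hB U hU).image2 (· ∩ ·) (hC V hV)).subset ?_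
  rintro _ ⟨⟨U', hU', V', hV', rfl⟩, x, hx, hx'⟩
  exact ⟨U', ⟨hU', x, hx.1, hx'.1⟩, V', ⟨hV', x, hx.2, hx'.2⟩, rfl⟩

theorem IsStarFiniteOpenCover.image2_inter {X : Type u} [TopologicalSpace X] {B C : Set (Set X)}
    (hB : IsStarFiniteOpenCover B) (hC : IsStarFiniteOpenCover C) :
    IsStarFiniteOpenCover (image2 (· ∩ ·) B C) := by
  refine ⟨isCover_of_forall fun x => ?_, hB.2.1.image2_inter hC.2.1, ?_⟩
  · obtain ⟨U, hU, hxU⟩ := hB.1.exists_mem x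
    obtain ⟨V, hV, hxV⟩ := hC.1.exists_mem x
    exact ⟨U ∩ V, ⟨U, hU, V, hV, rfl⟩, hxU, hxV⟩
  · rintro _ ⟨U, hU, V, hV, rfl⟩
    exact (hB.2.2 U hU).inter (hC.2.2 V hV)

theorem IsStarFinite.preimage {X Y : Type*} {C : Set (Set Y)} (hC : IsStarFinite C) (f : X → Y) :
    IsStarFinite ((f ⁻¹' ·) '' C) := by
  rintro _ ⟨U, hU, rfl⟩
  refine ((hC U hU).image (f ⁻¹' ·)).subset ?_
  rintro _ ⟨⟨V, hV, rfl⟩, x, hx, hx'⟩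
  exact ⟨V, ⟨hV, f x, hx, hx'⟩, rfl⟩

theorem IsStarFiniteOpenCover.preimage {X Y : Type*} [TopologicalSpace X] [TopologicalSpace Y]
    {C : Set (Set Y)} (hC : IsStarFiniteOpenCover C) {f : X → Y} (hf : Continuous f) :
    IsStarFiniteOpenCover ((f ⁻¹' ·) '' C) := by
  refine ⟨isCover_of_forall fun x => ?_, hC.2.1.preimage f, ?_⟩
  · obtain ⟨U, hU, hxU⟩ := hC.1.exists_mem (f x)
    exact ⟨_, ⟨U, hU, rfl⟩, hxU⟩
  · rintro _ ⟨U, hU, rfl⟩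
    exact (hC.2.2 U hU).preimage hf

/-- Finitely many star-finite open covers have a common star-finite open refinement that contains
all the intersections of their members. -/
theorem exists_isStarFiniteOpenCover_biInter {X : Type u} [TopologicalSpace X] {ι : Type*}
    (V : ι → Set (Set X)) (hV : ∀ i, IsStarFiniteOpenCover (V i)) (s : Finset ι) :
    ∃ W : Set (Set X), IsStarFiniteOpenCover W ∧
      ∀ v : ι → Set X, (∀ i ∈ s, v i ∈ V i) → ⋂ i ∈ s, v i ∈ W := by
  classical
  induction s using Finset.induction_on with
  | empty => exact ⟨_, isStarFiniteOpenCover_univ X, by simp⟩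
  | insert a s ha ih =>
    obtain ⟨W, hW, h⟩ := ih
    refine ⟨_, (hV a).image2_inter hW, fun v hv => ?_⟩
    rw [Finset.set_biInter_insert]
    exact ⟨v a, hv a (by simp), _, h v fun i hi => hv i (by simp [hi]), rfl⟩

/-- A countable family of star-finite open covers whose members form a base yields a strongly
metrizable space. -/
theorem isStronglyMetrizable_of_countable {X : Type u} [TopologicalSpace X] {ι : Type*}
    [Countable ι] [Nonempty ι] (V : ι → Set (Set X)) (hV : ∀ i, IsStarFiniteOpenCover (V i))
    (h : ∀ (x : X) (O : Set X), x ∈ O → IsOpen O → ∃ i, ∃ U ∈ V i, x ∈ U ∧ U ⊆ O) :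
    IsStronglyMetrizable X := by
  obtain ⟨e, he⟩ := exists_surjective_nat ι
  refine ⟨fun n => V (e n), fun n => hV (e n),
    TopologicalSpace.isTopologicalBasis_of_isOpen_of_nhds ?_ fun x O hx hO => ?_⟩
  · rintro U hU
    obtain ⟨n, hn⟩ := mem_iUnion.1 hU
    exact (hV _).2.2 U hn
  · obtain ⟨i, U, hU, hxU, hUO⟩ := h x O hx hO
    obtain ⟨n, rfl⟩ := he i
    exact ⟨U, mem_iUnion.2 ⟨n, hU⟩, hxU, hUO⟩

/-- A countable family of star-finite open covers whose members form a subbase yields a strongly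
metrizable space. -/
theorem isStronglyMetrizable_of_subbase {X : Type u} [TopologicalSpace X] {ι : Type*}
    [Countable ι] (V : ι → Set (Set X)) (hV : ∀ i, IsStarFiniteOpenCover (V i))
    (h : ∀ (x : X) (O : Set X), x ∈ O → IsOpen O → ∃ s : Finset ι, ∃ v : ι → Set X,
      (∀ i ∈ s, v i ∈ V i ∧ x ∈ v i) ∧ ⋂ i ∈ s, v i ⊆ O) :
    IsStronglyMetrizable X := by
  choose W hW hWV using exists_isStarFiniteOpenCover_biInter V hV
  refine isStronglyMetrizable_of_countable W hW fun x O hx hO => ?_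
  obtain ⟨s, v, hv, hvO⟩ := h x O hx hO
  exact ⟨s, _, hWV s v fun i hi => (hv i hi).1, mem_iInter₂.2 fun i hi => (hv i hi).2, hvO⟩

/-! ### Čech-completeness by complete sequences of covers -/

/-- A family of open covers is complete if every ultrafilter that contains a member of each of
them converges. -/
def IsCompleteFamily {X : Type u} [TopologicalSpace X] {ι : Type*} (V : ι → Set (Set X)) : Prop :=
  (∀ i, IsCover (V i) ∧ ∀ U ∈ V i, IsOpen U) ∧
    ∀ g : Ultrafilter X, (∀ i, ∃ U ∈ V i, U ∈ g) → ∃ x, (g : Filter X) ≤ 𝓝 x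

/-- Extend each cover to open sets of `βX`. If `p` lies in all the unions, an ultrafilter on `X`
tending to `p` contains a member of each cover, so it converges in `X`, and uniqueness of limits
puts `p` in the image. -/
theorem IsCompleteFamily.isCechComplete {X : Type u} [TopologicalSpace X] [T35Space X] {ι : Type*}
    [Countable ι] [Nonempty ι] {V : ι → Set (Set X)} (hV : IsCompleteFamily V) :
    IsCechComplete X := by
  obtain ⟨e, he⟩ := exists_surjective_nat ι
  refine ⟨fun n => ⋃₀ {O | IsOpen O ∧ ∃ U ∈ V (e n), stoneCechUnit ⁻¹' O ⊆ U},
    fun n => isOpen_sUnion fun O hO => hO.1, Subset.antisymm ?_ fun p hp => ?_⟩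
  · rintro _ ⟨x, rfl⟩
    refine mem_iInter.2 fun n => ?_
    obtain ⟨U, hU, hxU⟩ := (hV.1 (e n)).1.exists_mem x
    obtain ⟨O, hO, rfl⟩ := isInducing_stoneCechUnit.isOpen_iff.1 ((hV.1 (e n)).2 U hU)
    exact ⟨O, ⟨hO, _, hU, Subset.rfl⟩, hxU⟩
  · have := (isDenseInducing_stoneCechUnit (X := X)).comap_nhds_neBot p
    let g := Ultrafilter.of (comap (stoneCechUnit : X → StoneCech X) (𝓝 p))
    have hg : (g : Filter X) ≤ comap stoneCechUnit (𝓝 p) := Ultrafilter.of_le _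
    obtain ⟨x, hx⟩ := hV.2 g fun i => by
      obtain ⟨n, rfl⟩ := he i
      obtain ⟨O, ⟨hO, U, hU, hOU⟩, hpO⟩ := mem_iInter.1 hp n
      exact ⟨U, hU, mem_of_superset (hg (preimage_mem_comap (hO.mem_nhds hpO))) hOU⟩
    have h1 : Tendsto (stoneCechUnit : X → StoneCech X) g (𝓝 p) := tendsto_iff_comap.2 hg
    have h2 : Tendsto (stoneCechUnit : X → StoneCech X) g (𝓝 (stoneCechUnit x)) :=
      (continuous_stoneCechUnit.tendsto x).mono_left hx
    exact ⟨x, tendsto_nhds_unique h2 h1⟩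

/-- By compactness every ultrafilter has a limit in `βX`. Members whose closure in `βX` stays inside
`G n` force this limit into every `G n`, hence into `X`. -/
theorem IsCechComplete.exists_isCompleteFamily {X : Type u} [TopologicalSpace X] [T35Space X]
    (h : IsCechComplete X) : ∃ V : ℕ → Set (Set X), IsCompleteFamily V := by
  obtain ⟨G, hGo, hG⟩ := h
  have hmem (x : X) (n : ℕ) : stoneCechUnit x ∈ G n :=
    mem_iInter.1 (hG ▸ mem_range_self x : stoneCechUnit x ∈ ⋂ n, G n) n
  refine ⟨fun n => {U | IsOpen U ∧ closure (stoneCechUnit '' U) ⊆ G n},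
    fun n => ⟨isCover_of_forall fun x => ?_, fun U hU => hU.1⟩, fun g hg => ?_⟩
  · obtain ⟨K, hK, hKc, hKG⟩ := exists_mem_nhds_isClosed_subset ((hGo n).mem_nhds (hmem x n))
    refine ⟨stoneCechUnit ⁻¹' interior K,
      ⟨isOpen_interior.preimage continuous_stoneCechUnit, ?_⟩, mem_interior_iff_mem_nhds.2 hK⟩
    exact (closure_minimal ((image_preimage_subset _ _).trans interior_subset) hKc).trans hKG
  · obtain ⟨p, -, hp⟩ := isCompact_univ.ultrafilter_le_nhds
      (g.map (stoneCechUnit : X → StoneCech X)) (by simp)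
    have : p ∈ ⋂ n, G n := mem_iInter.2 fun n => by
      obtain ⟨U, hU, hUg⟩ := hg n
      exact hU.2 (mem_closure_iff_ultrafilter.2
        ⟨g.map stoneCechUnit, Ultrafilter.mem_map.2 (mem_of_superset hUg (subset_preimage_image _ _)), hp⟩)
    rw [← hG] at this
    obtain ⟨x, rfl⟩ := this
    refine ⟨x, ?_⟩
    rw [isInducing_stoneCechUnit.nhds_eq_comap]
    exact tendsto_iff_comap.1 hp

/-! ### Chains of a cover -/

/-- The graph on `X` in which two points are adjacent if they lie in a common member of `C`. -/
def coverGraph {X : Type u} (C : Set (Set X)) : SimpleGraph X :=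
  SimpleGraph.fromRel fun x y => ∃ U ∈ C, x ∈ U ∧ y ∈ U

theorem coverGraph_adj {X : Type u} {C : Set (Set X)} {x y : X} :
    (coverGraph C).Adj x y ↔ x ≠ y ∧ ∃ U ∈ C, x ∈ U ∧ y ∈ U := by
  simp only [coverGraph, SimpleGraph.fromRel_adj]
  grind

theorem coverGraph_reachable {X : Type u} {C : Set (Set X)} {x y : X} {U : Set X} (hU : U ∈ C)
    (hx : x ∈ U) (hy : y ∈ U) : (coverGraph C).Reachable x y := by
  by_cases h : x = y
  · exact h ▸ SimpleGraph.Reachable.rfl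
  · exact (coverGraph_adj.2 ⟨h, U, hU, hx, hy⟩).reachable

theorem coverGraph_dist_le {X : Type u} {C : Set (Set X)} {z x y : X} {U : Set X} (hU : U ∈ C)
    (hx : x ∈ U) (hy : y ∈ U) (hzx : (coverGraph C).Reachable z x) :
    (coverGraph C).dist z y ≤ (coverGraph C).dist z x + 1 := by
  by_cases h : x = y
  · simp [h]
  · obtain ⟨w, hw⟩ := hzx.exists_walk_length_eq_dist
    have := SimpleGraph.dist_le (w.concat (coverGraph_adj.2 ⟨h, U, hU, hx, hy⟩))
    rwa [SimpleGraph.Walk.length_concat, hw] at this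

theorem iterStar_mono {X : Type u} {B C : Set (Set X)} (hBC : CoverRefines B C) {S T : Set X}
    (hST : S ⊆ T) (m : ℕ) : iterStar B m S ⊆ iterStar C m T := by
  induction m with
  | zero => exact hST
  | succ m ih =>
    rintro x ⟨V, ⟨hV, y, hyV, hy⟩, hxV⟩
    obtain ⟨W, hW, hVW⟩ := hBC V hV
    exact ⟨W, ⟨hW, y, hVW hyV, ih hy⟩, hVW hxV⟩

theorem coverGraph_mem_iterStar {X : Type u} {C : Set (Set X)} {x y : X}
    (w : (coverGraph C).Walk y x) : y ∈ iterStar C w.length {x} := by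
  induction w with
  | nil => rfl
  | cons h p ih =>
    obtain ⟨-, U, hU, hx, hy⟩ := coverGraph_adj.1 h
    exact ⟨U, ⟨hU, _, hy, ih⟩, hx⟩

theorem subset_iterStar {X : Type u} {C : Set (Set X)} (hC : IsCover C) (A : Set X) {m n : ℕ}
    (h : m ≤ n) : iterStar C m A ⊆ iterStar C n A := by
  induction n, h using Nat.le_induction with
  | base => exact Subset.rfl
  | succ n _ ih =>
    intro x hx
    obtain ⟨U, hU, hxU⟩ := hC.exists_mem x
    exact ⟨U, ⟨hU, x, hxU, ih hx⟩, hxU⟩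

theorem isOpen_coverGraph_component {X : Type u} [TopologicalSpace X] {C : Set (Set X)}
    (hC : IsCover C) (ho : ∀ U ∈ C, IsOpen U) (c : (coverGraph C).ConnectedComponent) :
    IsOpen {x | (coverGraph C).connectedComponentMk x = c} := by
  refine isOpen_iff_mem_nhds.2 fun x hx => ?_
  obtain ⟨U, hU, hxU⟩ := hC.exists_mem x
  refine mem_of_superset ((ho U hU).mem_nhds hxU) fun y hy => ?_
  rw [mem_ofPred_eq, ← hx]
  exact SimpleGraph.ConnectedComponent.eq.2 (coverGraph_reachable hU hy hxU)

/-- A chain component of a star-countable cover meets only countably many of its members. -/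
theorem IsStarCountable.countable_component {X : Type u} {C : Set (Set X)} (hC : IsCover C)
    (hs : IsStarCountable C) (c : (coverGraph C).ConnectedComponent) :
    {U ∈ C | ∃ x ∈ U, (coverGraph C).connectedComponentMk x = c}.Countable := by
  obtain ⟨x, rfl⟩ := c.exists_rep
  have key (m : ℕ) : {U ∈ C | (U ∩ iterStar C m {x}).Nonempty}.Countable := by
    induction m with
    | zero =>
      obtain ⟨U, hU, hxU⟩ := hC.exists_mem x
      refine (hs U hU).mono ?_
      rintro V ⟨hV, y, hyV, rfl⟩
      exact ⟨hV, y, hxU, hyV⟩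
    | succ m ih =>
      refine (ih.biUnion fun V hV => hs V hV.1).mono ?_
      rintro W ⟨hW, y, hyW, V, hV, hyV⟩
      exact mem_biUnion (x := V) hV ⟨hW, y, hyV, hyW⟩
  refine (countable_iUnion key).mono ?_
  rintro U ⟨hU, y, hyU, hy⟩
  obtain ⟨w⟩ := SimpleGraph.ConnectedComponent.eq.1 hy
  exact mem_iUnion.2 ⟨w.length, hU, y, hyU, coverGraph_mem_iterStar w⟩

/-- Every open cover `C` has a star-finite open cover by annuli, each of which lies in an iterated
star of a member of `C`. -/
theorem exists_annuli {X : Type u} [TopologicalSpace X] {C : Set (Set X)}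
    (hC : IsCover C) (ho : ∀ U ∈ C, IsOpen U) :
    ∃ B, IsStarFiniteOpenCover B ∧ ∀ W ∈ B, ∃ m, ∃ U ∈ C, W ⊆ iterStar C m U := by
  let G := coverGraph C
  choose z hz using fun c : G.ConnectedComponent => c.exists_rep
  -- The sphere of radius `j` about the base point of `c` in the graph distance; the annuli are the
  -- stars of these spheres.
  let R (c : G.ConnectedComponent) (j : ℕ) : Set X :=
    {x | G.connectedComponentMk x = c ∧ G.dist (z c) x = j}
  have hreach (c : G.ConnectedComponent) (x : X) (hx : G.connectedComponentMk x = c) :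
      G.Reachable (z c) x :=
    SimpleGraph.ConnectedComponent.eq.1 ((hz c).trans hx.symm)
  have hstar (c j) (x : X) (hx : x ∈ coverStar C (R c j)) :
      G.connectedComponentMk x = c ∧ G.dist (z c) x ≤ j + 1 ∧ j ≤ G.dist (z c) x + 1 := by
    obtain ⟨U, ⟨hU, y, hyU, hyc, hyj⟩, hxU⟩ := hx
    have hx : G.connectedComponentMk x = c :=
      hyc ▸ SimpleGraph.ConnectedComponent.eq.2 (coverGraph_reachable hU hxU hyU)
    exact ⟨hx, hyj ▸ coverGraph_dist_le hU hyU hxU (hreach c y hyc),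
      hyj ▸ coverGraph_dist_le hU hxU hyU (hreach c x hx)⟩
  refine ⟨range fun p : G.ConnectedComponent × ℕ => coverStar C (R p.1 p.2),
    ⟨isCover_of_forall fun x => ?_, ?_, ?_⟩, ?_⟩
  · obtain ⟨U, hU, hxU⟩ := hC.exists_mem x
    exact ⟨_, ⟨(G.connectedComponentMk x, G.dist (z (G.connectedComponentMk x)) x), rfl⟩,
      U, ⟨hU, x, hxU, rfl, rfl⟩, hxU⟩
  · rintro _ ⟨⟨c, j⟩, rfl⟩
    -- A star changes the distance by at most one, so annuli that meet share their component and
    -- have indices at most two apart.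
    refine ((finite_le_nat (j + 2)).image fun i => coverStar C (R c i)).subset ?_
    rintro _ ⟨⟨⟨c', i⟩, rfl⟩, x, hx, hx'⟩
    have h := hstar c j x hx
    have h' := hstar c' i x hx'
    obtain rfl : c = c' := h.1.symm.trans h'.1
    exact ⟨i, by simp only [mem_ofPred_eq]; omega, rfl⟩
  · rintro _ ⟨⟨c, j⟩, rfl⟩
    exact isOpen_sUnion fun U hU => ho U hU.1
  · rintro _ ⟨⟨c, j⟩, rfl⟩
    obtain ⟨U, hU, hzU⟩ := hC.exists_mem (z c)
    refine ⟨j + 1, U, hU, fun x hx => ?_⟩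
    have h := hstar c j x hx
    obtain ⟨w, hw⟩ := (hreach c x h.1).symm.exists_walk_length_eq_dist
    have hx := coverGraph_mem_iterStar w
    rw [hw, SimpleGraph.dist_comm] at hx
    exact iterStar_mono (fun V hV => ⟨V, hV, Subset.rfl⟩) (singleton_subset_iff.2 hzU) _
      (subset_iterStar hC _ h.2.1 hx)

/-! ### Uniform covers -/

theorem isCover_of_mem_uniformCovers {X : Type u} [UniformSpace X] {C : Set (Set X)}
    (hC : C ∈ uniformCovers X) : IsCover C := by
  obtain ⟨V, hV, h⟩ := hC
  refine isCover_of_forall fun x => ?_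
  obtain ⟨U, hU, hVU⟩ := h x
  exact ⟨U, hU, hVU (UniformSpace.mem_ball_self x hV)⟩

theorem mem_uniformCovers_of_refines {X : Type u} [UniformSpace X] {B C : Set (Set X)}
    (hB : B ∈ uniformCovers X) (hBC : CoverRefines B C) : C ∈ uniformCovers X := by
  obtain ⟨V, hV, h⟩ := hB
  refine ⟨V, hV, fun x => ?_⟩
  obtain ⟨U, hU, hVU⟩ := h x
  obtain ⟨W, hW, hUW⟩ := hBC U hU
  exact ⟨W, hW, hVU.trans hUW⟩

theorem range_ball_mem_uniformCovers {X : Type u} [MetricSpace X] {ε : ℝ} (hε : 0 < ε) :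
    range (fun x : X => Metric.ball x ε) ∈ uniformCovers X := by
  refine ⟨_, Metric.dist_mem_uniformity hε, fun x => ⟨_, mem_range_self x, fun y hy => ?_⟩⟩
  rw [Metric.mem_ball, dist_comm]
  exact hy

/-- Convergence is asked of Cauchy ultrafilters only, which both completeness and
Bourbaki-completeness supply. -/
theorem isCompleteFamily_ball {X : Type u} [MetricSpace X] (h : ∀ g : Ultrafilter X,
    Cauchy (g : Filter X) → ∃ x, (g : Filter X) ≤ 𝓝 x) :
    IsCompleteFamily fun n : ℕ => range fun x : X => Metric.ball x (1 / (n + 1)) := by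
  refine ⟨fun n => ⟨isCover_of_mem_uniformCovers (range_ball_mem_uniformCovers (by positivity)),
    by rintro _ ⟨x, rfl⟩; exact Metric.isOpen_ball⟩, fun g hg => h g ?_⟩
  refine Metric.cauchy_iff.2 ⟨g.neBot, fun ε hε => ?_⟩
  obtain ⟨n, hn⟩ := exists_nat_one_div_lt (half_pos hε)
  obtain ⟨_, ⟨x, rfl⟩, hx⟩ := hg n
  refine ⟨_, hx, fun y hy z hz => ?_⟩
  have := dist_triangle_right y z x
  rw [Metric.mem_ball] at hy hz
  linarith

theorem isCechComplete_of_completeSpace {X : Type u} [MetricSpace X] [CompleteSpace X] :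
    IsCechComplete X :=
  (isCompleteFamily_ball fun _ hg => CompleteSpace.complete hg).isCechComplete

/-! ### Star-finite bases and Bourbaki-completeness -/

theorem IsStarFinite.iterStar_subset {X : Type u} {C : Set (Set X)} (hC : IsStarFinite C)
    {U : Set X} (hU : U ∈ C) (m : ℕ) : ∃ T ⊆ C, T.Finite ∧ iterStar C m U ⊆ ⋃₀ T := by
  induction m with
  | zero => exact ⟨{U}, by simpa using hU, finite_singleton U, by simp [iterStar]⟩
  | succ m ih =>
    obtain ⟨T, hTC, hT, h⟩ := ih
    refine ⟨⋃ V ∈ T, {W ∈ C | (V ∩ W).Nonempty}, by simp,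
      hT.biUnion fun V hV => hC V (hTC hV), ?_⟩
    rintro x ⟨W, ⟨hW, y, hyW, hy⟩, hxW⟩
    obtain ⟨V, hV, hyV⟩ := h hy
    exact ⟨W, mem_biUnion hV ⟨hW, y, hyV, hyW⟩, hxW⟩

/-- An iterated star of a member of a star-finite cover lies in a finite union of members, and an
ultrafilter containing the union contains one of them. Hence ultrafilters finer than a
Bourbaki-Cauchy filter are Cauchy. -/
theorem isBourbakiComplete_of_starFinite {X : Type u} [UniformSpace X] [CompleteSpace X]
    (h : uniformCovers X = starFiniteModification X) : IsBourbakiComplete X := by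
  intro F hF hFB
  let g := Ultrafilter.of F
  have hg : (g : Filter X) ≤ F := Ultrafilter.of_le F
  have hc : Cauchy (g : Filter X) := by
    refine ⟨g.neBot, fun V hV => ?_⟩
    obtain ⟨W, hW, hWs, hWV⟩ := comp_symm_mem_uniformity_sets hV
    have hB : range (fun x : X => UniformSpace.ball x W) ∈ starFiniteModification X := by
      rw [← h]
      exact ⟨W, hW, fun x => ⟨_, mem_range_self x, Subset.rfl⟩⟩
    obtain ⟨B, hBu, hBs, -, hBC⟩ := hB
    obtain ⟨m, U, hU, S, hS, hSU⟩ := hFB B hBu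
    obtain ⟨T, hTB, hT, hUT⟩ := hBs.iterStar_subset hU m
    obtain ⟨t, htT, htg⟩ := (Ultrafilter.finite_sUnion_mem_iff hT).1
      (mem_of_superset (hg hS) (hSU.trans hUT))
    obtain ⟨_, ⟨x, rfl⟩, htx⟩ := hBC t (hTB htT)
    refine mem_of_superset (prod_mem_prod htg htg) ?_
    rintro ⟨y, z⟩ ⟨hy, hz⟩
    have hxy : (x, y) ∈ W := htx hy
    have hyx : (y, x) ∈ W := hWs.symm _ _ hxy
    exact hWV ⟨x, hyx, htx hz⟩
  obtain ⟨x, hx⟩ := CompleteSpace.complete hc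
  exact ⟨x, (ClusterPt.of_le_nhds hx).mono hg⟩

/-- Otherwise the finite intersections with finitely many balls removed generate a proper filter. It
is Bourbaki-Cauchy because it contains every `v n`, yet it cannot cluster at `z`, since the ball
about `z` is among those removed. -/
theorem IsBourbakiComplete.exists_biInter_subset_biUnion_ball {X : Type u} [MetricSpace X]
    (h : IsBourbakiComplete X) (A : ℕ → Set (Set X))
    (hA : ∀ n, ∀ W ∈ A n, ∃ m, ∃ U ∈ range (fun x : X => Metric.ball x (1 / ((n : ℝ) + 1))),
      W ⊆ iterStar (range fun x : X => Metric.ball x (1 / ((n : ℝ) + 1))) m U)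
    (v : ℕ → Set X) (hv : ∀ n, v n ∈ A n) {ε : ℝ} (hε : 0 < ε) :
    ∃ s : Finset ℕ, ∃ t : Set X, t.Finite ∧ ⋂ n ∈ s, v n ⊆ ⋃ x ∈ t, Metric.ball x ε := by
  by_contra! hcon
  let F : Filter X := ⨅ p : Finset ℕ × {t : Set X // t.Finite},
    𝓟 ((⋂ n ∈ p.1, v n) \ ⋃ x ∈ p.2.1, Metric.ball x ε)
  have hmem (p : Finset ℕ × {t : Set X // t.Finite}) :
      (⋂ n ∈ p.1, v n) \ ⋃ x ∈ p.2.1, Metric.ball x ε ∈ F :=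
    mem_iInf_of_mem p (mem_principal_self _)
  have : Nonempty (Finset ℕ × {t : Set X // t.Finite}) := ⟨∅, ∅, finite_empty⟩
  have hF : F.NeBot := by
    classical
    refine iInf_neBot_of_directed' ?_ fun p => ?_
    · rintro ⟨s, t, ht⟩ ⟨s', t', ht'⟩
      refine ⟨(s ∪ s', ⟨t ∪ t', ht.union ht'⟩), ?_, ?_⟩
      · simp only [ge_iff_le, principal_mono]
        exact sdiff_subset_sdiff (biInter_subset_biInter_left fun n hn => by simp_all)
          (biUnion_subset_biUnion_left subset_union_left)
      · simp only [ge_iff_le, principal_mono]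
        exact sdiff_subset_sdiff (biInter_subset_biInter_left fun n hn => by simp_all)
          (biUnion_subset_biUnion_left subset_union_right)
    · rw [principal_neBot_iff, sdiff_nonempty]
      exact hcon p.1 p.2.1 p.2.2
  obtain ⟨z, hz⟩ := h F hF fun C hC => by
    obtain ⟨V, hV, hVC⟩ := hC
    obtain ⟨δ, hδ, hδV⟩ := Metric.mem_uniformity_dist.1 hV
    obtain ⟨n, hn⟩ := exists_nat_one_div_lt hδ
    obtain ⟨m, U, ⟨x, rfl⟩, hU⟩ := hA n (v n) (hv n)
    have hball (x : X) : Metric.ball x (1 / ((n : ℝ) + 1)) ⊆ UniformSpace.ball x V := fun y hy =>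
      hδV (by rw [dist_comm]; exact (Metric.mem_ball.1 hy).trans hn)
    obtain ⟨O, hO, hxO⟩ := hVC x
    refine ⟨m, O, hO, v n, mem_of_superset (hmem ({n}, ⟨∅, finite_empty⟩)) (by simp),
      hU.trans (iterStar_mono ?_ ((hball x).trans hxO) m)⟩
    rintro _ ⟨y, rfl⟩
    obtain ⟨O', hO', hyO'⟩ := hVC y
    exact ⟨O', hO', (hball y).trans hyO'⟩
  obtain ⟨y, hy, -, hy'⟩ := clusterPt_iff_nonempty.1 hz (Metric.ball_mem_nhds z hε)
    (hmem (∅, ⟨{z}, finite_singleton z⟩))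
  simp at hy'
  exact absurd (Metric.mem_ball.1 hy) (not_lt.2 hy')

theorem isStronglyMetrizable_of_isBourbakiComplete {X : Type u} [MetricSpace X]
    (h : IsBourbakiComplete X) : IsStronglyMetrizable X := by
  classical
  choose A hA hAs using fun n : ℕ => exists_annuli
    (isCover_of_mem_uniformCovers
      (range_ball_mem_uniformCovers (X := X) (ε := 1 / ((n : ℝ) + 1)) (by positivity)))
    (by rintro _ ⟨x, rfl⟩; exact Metric.isOpen_ball)
  choose W hW hWA using exists_isStarFiniteOpenCover_biInter A hA
  let P (k : ℕ) (w : Set X) (t : Set X) : Prop :=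
    t.Finite ∧ w ⊆ ⋃ x ∈ t, Metric.ball x (1 / ((k : ℝ) + 1))
  let Φ (k : ℕ) (w : Set X) : Set (Set X) :=
    -- A set `w` without a finite cover by balls stays uncut, so that the result is still a
    -- star-finite cover; the base property only uses sets that are cut.
    if h : ∃ t, P k w t then (fun x => Metric.ball x (1 / ((k : ℝ) + 1))) '' h.choose else {univ}
  have hΦf (k w) : (Φ k w).Finite := by
    by_cases h : ∃ t, P k w t
    · simpa only [Φ, dif_pos h] using h.choose_spec.1.image _
    · simp only [Φ, dif_neg h, finite_singleton]
  have hΦo (k w) : ∀ b ∈ Φ k w, IsOpen b := by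
    by_cases h : ∃ t, P k w t
    · simp only [Φ, dif_pos h]
      rintro _ ⟨x, -, rfl⟩
      exact Metric.isOpen_ball
    · simp [Φ, dif_neg h]
  have hΦc (k w) : ∀ x ∈ w, ∃ b ∈ Φ k w, x ∈ b := by
    by_cases h : ∃ t, P k w t
    · simp only [Φ, dif_pos h]
      intro x hx
      obtain ⟨y, hy, hxy⟩ := mem_iUnion₂.1 (h.choose_spec.2 hx)
      exact ⟨_, mem_image_of_mem _ hy, hxy⟩
    · simp [Φ, dif_neg h]
  refine isStronglyMetrizable_of_countable
    (fun p : Finset ℕ × ℕ => ⋃ w ∈ W p.1, (w ∩ ·) '' Φ p.2 w) ?_ ?_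
  · rintro ⟨s, k⟩
    refine ⟨isCover_of_forall fun x => ?_, fun U hU => ?_, fun U hU => ?_⟩
    · obtain ⟨w, hw, hxw⟩ := (hW s).1.exists_mem x
      obtain ⟨b, hb, hxb⟩ := hΦc k w x hxw
      exact ⟨_, mem_biUnion hw (mem_image_of_mem _ hb), hxw, hxb⟩
    · obtain ⟨w, hw, b, hb, rfl⟩ := mem_iUnion₂.1 hU
      refine (((hW s).2.1 w hw).biUnion fun w' _ => (hΦf k w').image (w' ∩ ·)).subset ?_
      rintro U' ⟨hU', x, hx, hx'⟩
      obtain ⟨w', hw', b', hb', rfl⟩ := mem_iUnion₂.1 hU'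
      exact mem_biUnion (x := w') ⟨hw', x, hx.1, hx'.1⟩ (mem_image_of_mem _ hb')
    · obtain ⟨w, hw, b, hb, rfl⟩ := mem_iUnion₂.1 hU
      exact ((hW s).2.2 w hw).inter (hΦo k w b hb)
  · intro x O hx hO
    obtain ⟨ε, hε, hεO⟩ := Metric.isOpen_iff.1 hO x hx
    obtain ⟨k, hk⟩ := exists_nat_one_div_lt (half_pos hε)
    choose v hv hxv using fun n => (hA n).1.exists_mem x
    obtain ⟨s, t, ht, hst⟩ := IsBourbakiComplete.exists_biInter_subset_biUnion_ball h A hAs v hv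
      (ε := 1 / ((k : ℝ) + 1)) (by positivity)
    have hP : ∃ t, P k (⋂ n ∈ s, v n) t := ⟨t, ht, hst⟩
    have hxs : x ∈ ⋂ n ∈ s, v n := mem_iInter₂.2 fun n _ => hxv n
    obtain ⟨b, hb, hxb⟩ := hΦc k _ x hxs
    refine ⟨(s, k), _, mem_biUnion (hWA s v fun n _ => hv n) (mem_image_of_mem _ hb),
      ⟨hxs, hxb⟩, fun y hy => hεO ?_⟩
    simp only [Φ, dif_pos hP] at hb
    obtain ⟨z, -, rfl⟩ := hb
    have h1 := Metric.mem_ball.1 hxb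
    have h2 := Metric.mem_ball.1 hy.2
    have := dist_triangle_right y x z
    rw [Metric.mem_ball]
    linarith

theorem isCechComplete_of_isBourbakiComplete {X : Type u} [MetricSpace X]
    (h : IsBourbakiComplete X) : IsCechComplete X := by
  refine (isCompleteFamily_ball fun g hg => ?_).isCechComplete
  obtain ⟨x, hx⟩ := h g g.neBot fun C hC => by
    obtain ⟨V, hV, hVC⟩ := hC
    obtain ⟨S, hS, hSV⟩ := mem_prod_same_iff.1 (hg.2 hV)
    obtain ⟨x, hxS⟩ := g.neBot.nonempty_of_mem hS
    obtain ⟨U, hU, hxU⟩ := hVC x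
    -- Cauchy filters are Bourbaki-Cauchy with no iteration of the star.
    exact ⟨0, U, hU, S, hS, fun y hy => hxU (hSV (mk_mem_prod hxS hy))⟩
  exact ⟨x, (Ultrafilter.clusterPt_iff).1 hx⟩

/-! ### Star-countable bases -/

/-- In a metric space, star-countable open covers have star-finite open refinements. -/
theorem IsStarCountable.exists_isStarFiniteOpenCover {X : Type u} [MetricSpace X]
    {C : Set (Set X)} (hC : IsCover C) (hs : IsStarCountable C) (ho : ∀ U ∈ C, IsOpen U) :
    ∃ B, IsStarFiniteOpenCover B ∧ CoverRefines B C := by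
  let G := coverGraph C
  have (c : G.ConnectedComponent) : ∃ f : ℕ → Set X, range f =
      {U ∈ C | ∃ x ∈ U, (coverGraph C).connectedComponentMk x = c} := by
    obtain ⟨x, rfl⟩ := c.exists_rep
    obtain ⟨U, hU, hxU⟩ := hC.exists_mem x
    obtain ⟨f, hf⟩ := (hs.countable_component hC (G.connectedComponentMk x)).exists_eq_range
      ⟨U, hU, x, hxU, rfl⟩
    exact ⟨f, hf.symm⟩
  choose f hf using this
  have hfC (c k) : f c k ∈ C := by
    have := mem_range_self (f := f c) k
    rw [hf] at this
    exact this.1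
  -- Collecting the `k`-th members over all components makes a countable open cover; its parts in
  -- distinct components are disjoint.
  let O (k : ℕ) : Set X := {x | x ∈ f (G.connectedComponentMk x) k}
  have hO (k) : IsOpen (O k) := by
    refine isOpen_iff_mem_nhds.2 fun x hx => ?_
    filter_upwards [(ho _ (hfC _ k)).mem_nhds hx,
      (isOpen_coverGraph_component hC ho (G.connectedComponentMk x)).mem_nhds rfl] with y hy hy'
    simpa only [O, mem_ofPred_eq, G, hy'] using hy
  have hex (x : X) : ∃ k, x ∈ O k := by
    obtain ⟨U, hU, hxU⟩ := hC.exists_mem x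
    have : U ∈ range (f (G.connectedComponentMk x)) := by
      rw [hf]
      exact ⟨hU, x, hxU, rfl⟩
    obtain ⟨k, rfl⟩ := this
    exact ⟨k, hxU⟩
  -- The admissible values at `x` are upward closed in `[0, ∞)`, hence convex, and the constant `k`
  -- is admissible on `O k`. So `g x` bounds some index `k` with `x ∈ O k`, and the strip of `g`
  -- around `j` needs only `k ≤ j`.
  obtain ⟨g, hg⟩ := exists_continuous_forall_mem_convex_of_local_const (X := X) (E := ℝ)
    (t := fun x => {r : ℝ | ∃ k : ℕ, x ∈ O k ∧ (k : ℝ) ≤ r} ∩ Ici 0)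
    (fun x => (OrdConnected.convex ⟨by
      rintro a ⟨⟨k, hk, hka⟩, ha0⟩ b - c hc
      exact ⟨⟨k, hk, hka.trans hc.1⟩, le_trans ha0 hc.1⟩⟩)) fun x => by
      obtain ⟨k, hk⟩ := hex x
      exact ⟨k, Eventually.mono ((hO k).mem_nhds hk) fun y hy => ⟨⟨k, hy, le_rfl⟩, mem_Ici.2 (Nat.cast_nonneg k)⟩⟩
  refine ⟨range fun p : G.ConnectedComponent × (Σ j : ℕ, Fin (j + 1)) =>
    {x | G.connectedComponentMk x = p.1} ∩ (O p.2.2 ∩ g ⁻¹' Ioo ((p.2.1 : ℝ) - 1) (p.2.1 + 1)),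
    ⟨isCover_of_forall fun x => ?_, ?_, ?_⟩, ?_⟩
  · obtain ⟨⟨k, hk, hkg⟩, hg0⟩ := hg x
    have h1 : (k : ℕ) ≤ ⌊g x⌋₊ := Nat.le_floor hkg
    have h2 := Nat.floor_le (mem_Ici.1 hg0)
    have h3 := Nat.lt_floor_add_one (g x)
    exact ⟨_, ⟨(G.connectedComponentMk x, ⟨⌊g x⌋₊, ⟨k, by omega⟩⟩), rfl⟩, rfl, hk, by linarith, h3⟩
  · rintro _ ⟨⟨c, j, k⟩, rfl⟩
    have hfin : (⋃ i ∈ Iic (j + 1), range fun k : Fin (i + 1) =>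
        {x | G.connectedComponentMk x = c} ∩ (O k ∩ g ⁻¹' Ioo ((i : ℝ) - 1) (i + 1))).Finite :=
      (finite_Iic (j + 1)).biUnion fun i _ => finite_range _
    refine hfin.subset ?_
    rintro _ ⟨⟨⟨c', i, l⟩, rfl⟩, x, ⟨rfl, -, hx⟩, ⟨rfl, -, hx'⟩⟩
    have : (i : ℝ) < j + 2 := by linarith [hx.2, hx'.1]
    have : i < j + 2 := by exact_mod_cast this
    exact mem_biUnion (x := i) (by simp only [mem_Iic]; omega) ⟨l, rfl⟩
  · rintro _ ⟨⟨c, j, k⟩, rfl⟩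
    exact (isOpen_coverGraph_component hC ho c).inter
      ((hO k).inter (isOpen_Ioo.preimage g.continuous))
  · rintro _ ⟨⟨c, j, k⟩, rfl⟩
    exact ⟨f c k, hfC c k, by rintro x ⟨rfl, hx, -⟩; exact hx⟩

theorem isStronglyMetrizable_of_starCountable {X : Type u} [MetricSpace X]
    (h : uniformCovers X = starCountableModification X) : IsStronglyMetrizable X := by
  have (n : ℕ) : ∃ B, IsStarFiniteOpenCover B ∧
      CoverRefines B (range fun x : X => Metric.ball x (1 / ((n : ℝ) + 1))) := by
    have hu : range (fun x : X => Metric.ball x (1 / ((n : ℝ) + 1))) ∈ starCountableModification X :=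
      h ▸ range_ball_mem_uniformCovers (by positivity)
    obtain ⟨B, ⟨V, hV, hVB⟩, hBs, hBC⟩ := hu
    -- Members of a star-countable uniform cover need not be open, but their interiors still cover.
    have hc : IsCover (interior '' B) := isCover_of_forall fun x => by
      obtain ⟨U, hU, hxU⟩ := hVB x
      exact ⟨_, mem_image_of_mem _ hU,
        mem_interior_iff_mem_nhds.2 (mem_of_superset (UniformSpace.ball_mem_nhds x hV) hxU)⟩
    have hs : IsStarCountable (interior '' B) := by
      rintro _ ⟨U, hU, rfl⟩
      refine ((hBs U hU).image interior).mono ?_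
      rintro _ ⟨⟨W, hW, rfl⟩, x, hx, hx'⟩
      exact ⟨W, ⟨hW, x, interior_subset hx, interior_subset hx'⟩, rfl⟩
    obtain ⟨D, hD, hDB⟩ := hs.exists_isStarFiniteOpenCover hc
      (by rintro _ ⟨U, -, rfl⟩; exact isOpen_interior)
    refine ⟨D, hD, fun U hU => ?_⟩
    obtain ⟨_, ⟨W, hW, rfl⟩, hUW⟩ := hDB U hU
    obtain ⟨O, hO, hWO⟩ := hBC W hW
    exact ⟨O, hO, hUW.trans (interior_subset.trans hWO)⟩
  choose B hB hBr using this
  refine isStronglyMetrizable_of_countable B hB fun x O hx hO => ?_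
  obtain ⟨ε, hε, hεO⟩ := Metric.isOpen_iff.1 hO x hx
  obtain ⟨k, hk⟩ := exists_nat_one_div_lt (half_pos hε)
  obtain ⟨U, hU, hxU⟩ := (hB k).1.exists_mem x
  obtain ⟨_, ⟨z, rfl⟩, hUz⟩ := hBr k U hU
  refine ⟨k, U, hU, hxU, fun y hy => hεO ?_⟩
  have h1 := Metric.mem_ball.1 (hUz hxU)
  have h2 := Metric.mem_ball.1 (hUz hy)
  have := dist_triangle_right y x z
  rw [Metric.mem_ball]
  linarith

/-! ### Countable products of locally compact metric spaces -/

/-- Paracompactness gives a locally finite refinement by small relatively compact sets, and a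
compact closure meets only finitely many of them. -/
theorem exists_isStarFiniteOpenCover_of_locallyCompact {Y : Type u} [MetricSpace Y]
    [LocallyCompactSpace Y] {ε : ℝ} (hε : 0 < ε) : ∃ B : Set (Set Y), IsStarFiniteOpenCover B ∧
      ∀ U ∈ B, IsCompact (closure U) ∧ ∃ y, U ⊆ Metric.ball y ε := by
  have (y : Y) : ∃ K, IsCompact K ∧ K ∈ 𝓝 y := exists_compact_mem_nhds y
  choose K hK hKy using this
  obtain ⟨v, hvo, hvc, hvf, hv⟩ := precise_refinement
    (fun y : Y => interior (K y) ∩ Metric.ball y ε)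
    (fun y => isOpen_interior.inter Metric.isOpen_ball)
    (eq_univ_of_forall fun y => mem_iUnion.2
      ⟨y, mem_interior_iff_mem_nhds.2 (hKy y), Metric.mem_ball_self hε⟩)
  have hcl (y) : IsCompact (closure (v y)) := (hK y).of_isClosed_subset isClosed_closure
    (closure_minimal ((hv y).trans (inter_subset_left.trans interior_subset)) (hK y).isClosed)
  refine ⟨range v, ⟨isCover_of_forall fun x => ?_, ?_, ?_⟩, ?_⟩
  · obtain ⟨y, hy⟩ := mem_iUnion.1 (hvc ▸ mem_univ x : x ∈ ⋃ y, v y)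
    exact ⟨_, mem_range_self y, hy⟩
  · rintro _ ⟨y, rfl⟩
    refine ((hvf.finite_nonempty_inter_compact (hcl y)).image v).subset ?_
    rintro _ ⟨⟨z, rfl⟩, x, hx, hx'⟩
    exact ⟨z, ⟨x, hx', subset_closure hx⟩, rfl⟩
  · rintro _ ⟨y, rfl⟩
    exact hvo y
  · rintro _ ⟨y, rfl⟩
    exact ⟨hcl y, y, (hv y).trans inter_subset_right⟩

/-- Pulled back from the factors, relatively compact covers make ultrafilters converge
coordinatewise, with limit in the closed image; covers of mesh tending to zero give a subbase. -/
theorem isCechComplete_and_isStronglyMetrizable_of_isClosedEmbedding {X : Type u}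
    [TopologicalSpace X] [T35Space X] {ι : Type} [Countable ι] {Y : ι → Type u}
    [∀ i, MetricSpace (Y i)] [∀ i, LocallyCompactSpace (Y i)] {f : X → ∀ i, Y i}
    (hf : IsClosedEmbedding f) : IsCechComplete X ∧ IsStronglyMetrizable X := by
  classical
  choose B hB hBc using fun (i : ι) (n : ℕ) =>
    exists_isStarFiniteOpenCover_of_locallyCompact (Y := Y i) (ε := 1 / ((n : ℝ) + 1))
      (by positivity)
  have hfi (i) : Continuous fun x => f x i := (continuous_apply i).comp hf.continuous
  constructor
  -- The extra trivial cover keeps the index type nonempty when the product has no factors.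
  · refine IsCompleteFamily.isCechComplete (ι := Option ι)
      (V := fun o => o.elim {univ} fun i => ((fun x => f x i) ⁻¹' ·) '' B i 0) ⟨?_, fun g hg => ?_⟩
    · rintro (_ | i)
      · exact ⟨(isStarFiniteOpenCover_univ X).1, (isStarFiniteOpenCover_univ X).2.2⟩
      · exact ⟨((hB i 0).preimage (hfi i)).1, ((hB i 0).preimage (hfi i)).2.2⟩
    · have (i : ι) : ∃ y, Tendsto (fun x => f x i) g (𝓝 y) := by
        obtain ⟨_, ⟨U, hU, rfl⟩, hUg⟩ := hg (some i)
        obtain ⟨y, -, hy⟩ := (hBc i 0 U hU).1.ultrafilter_le_nhds (g.map fun x => f x i)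
          (le_principal_iff.2 (mem_of_superset hUg (preimage_mono subset_closure)))
        exact ⟨y, hy⟩
      choose y hy using this
      have hy : Tendsto f g (𝓝 y) := tendsto_pi_nhds.2 hy
      obtain ⟨x, rfl⟩ : y ∈ range f := hf.isClosed_range.mem_of_tendsto hy
        (Eventually.of_forall mem_range_self)
      exact ⟨x, by rw [hf.isInducing.nhds_eq_comap]; exact tendsto_iff_comap.1 hy⟩
  · refine isStronglyMetrizable_of_subbase
      (fun p : ι × ℕ => ((fun x => f x p.1) ⁻¹' ·) '' B p.1 p.2)
      (fun p => (hB p.1 p.2).preimage (hfi p.1)) fun x O hx hO => ?_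
    obtain ⟨O', hO', rfl⟩ := hf.isInducing.isOpen_iff.1 hO
    obtain ⟨s, r, hr, hsub⟩ := isOpen_pi_iff.1 hO' (f x) hx
    -- The factor 2 is needed because a member of the cover lies in a ball that need not be centred
    -- at `f x i`.
    have (i : ι) : ∃ n : ℕ, i ∈ s → Metric.ball (f x i) (2 * (1 / ((n : ℝ) + 1))) ⊆ r i := by
      by_cases hi : i ∈ s
      · obtain ⟨ε, hε, h⟩ := Metric.isOpen_iff.1 (hr i hi).1 _ (hr i hi).2
        obtain ⟨n, hn⟩ := exists_nat_one_div_lt (half_pos hε)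
        exact ⟨n, fun _ => (Metric.ball_subset_ball (by linarith)).trans h⟩
      · exact ⟨0, fun h => absurd h hi⟩
    choose n hn using this
    choose U hU hxU using fun i => (hB i (n i)).1.exists_mem (f x i)
    refine ⟨s.image fun i => (i, n i), fun p => (fun x => f x p.1) ⁻¹' U p.1, ?_, ?_⟩
    · intro p hp
      obtain ⟨i, hi, rfl⟩ := Finset.mem_image.1 hp
      exact ⟨⟨_, hU i, rfl⟩, hxU i⟩
    · intro z hz
      refine hsub fun i hi => hn i hi ?_
      have hz : f z i ∈ U i := mem_iInter₂.1 hz (i, n i) (Finset.mem_image_of_mem _ hi)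
      obtain ⟨y, hy⟩ := (hBc i (n i) (U i) (hU i)).2
      have h1 := Metric.mem_ball.1 (hy hz)
      have h2 := Metric.mem_ball.1 (hy (hxU i))
      have := dist_triangle_right (f z i) (f x i) y
      rw [Metric.mem_ball]
      linarith

/-! ### Closed subspaces and closed embeddings -/

theorem HomeomorphicToClosedSubspace.exists_isClosedEmbedding {X Y : Type*} [TopologicalSpace X]
    [TopologicalSpace Y] (h : HomeomorphicToClosedSubspace X Y) :
    ∃ f : X → Y, IsClosedEmbedding f := by
  obtain ⟨S, hS, ⟨e⟩⟩ := h
  exact ⟨_, hS.isClosedEmbedding_subtypeVal.comp e.isClosedEmbedding⟩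

theorem Topology.IsClosedEmbedding.homeomorphicToClosedSubspace {X Y : Type*} [TopologicalSpace X]
    [TopologicalSpace Y] {f : X → Y} (hf : IsClosedEmbedding f) :
    HomeomorphicToClosedSubspace X Y :=
  ⟨range f, hf.isClosed_range, ⟨hf.isEmbedding.toHomeomorph⟩⟩

theorem Topology.IsClosedEmbedding.homeomorphicToClosedSubspace_pi {X D : Type u}
    [TopologicalSpace X] [TopologicalSpace D] {f : X → (ℕ → D) × (ℕ → ℝ)}
    (hf : IsClosedEmbedding f) : HomeomorphicToClosedSubspace X (ℕ → D × ULift.{u} ℝ) := by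
  let g : ((ℕ → D) × (ℕ → ℝ)) ≃ₜ (ℕ → D × ULift.{u} ℝ) :=
    { toFun := fun p n => (p.1 n, ULift.up (p.2 n))
      invFun := fun q => (fun n => (q n).1, fun n => (q n).2.down)
      left_inv := fun p => rfl
      right_inv := fun q => rfl
      continuous_toFun := by fun_prop
      continuous_invFun := by fun_prop }
  exact (g.isClosedEmbedding.comp hf).homeomorphicToClosedSubspace

instance locallyCompactSpace_uLift_real : LocallyCompactSpace (ULift.{u} ℝ) :=
  Homeomorph.ulift.isClosedEmbedding.locallyCompactSpace

/-! ### Uniformities with a star-finite base -/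

/-- `B` is a star-finite open uniform cover all of whose members are `V`-small. -/
def IsSmallStarFiniteCover {X : Type u} [UniformSpace X] (V : Set (X × X)) (B : Set (Set X)) :
    Prop :=
  B ∈ uniformCovers X ∧ IsStarFinite B ∧ (∀ U ∈ B, IsOpen U) ∧ ∀ U ∈ B, U ×ˢ U ⊆ V

/-- The filter of the sets `V` for which there is a `V`-small star-finite open uniform cover. -/
def starFiniteFilter (X : Type u) [UniformSpace X] : Filter (X × X) where
  sets := {V | ∃ B, IsSmallStarFiniteCover V B}
  univ_sets := by
    refine ⟨{univ}, ⟨univ, univ_mem, by simp⟩, (isStarFiniteOpenCover_univ X).2.1, ?_⟩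
    simp
  sets_of_superset := by
    rintro V W ⟨B, h1, h2, h3, h4⟩ hVW
    exact ⟨B, h1, h2, h3, fun U hU => (h4 U hU).trans hVW⟩
  inter_sets := by
    rintro V W ⟨B, ⟨N, hN, hNB⟩, h2, h3, h4⟩ ⟨C, ⟨M, hM, hMC⟩, k2, k3, k4⟩
    refine ⟨image2 (· ∩ ·) B C, ⟨N ∩ M, inter_mem hN hM, fun x => ?_⟩, h2.image2_inter k2, ?_, ?_⟩
    · obtain ⟨U, hU, hxU⟩ := hNB x
      obtain ⟨U', hU', hxU'⟩ := hMC x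
      exact ⟨_, ⟨U, hU, U', hU', rfl⟩, fun y hy => ⟨hxU hy.1, hxU' hy.2⟩⟩
    · rintro _ ⟨U, hU, U', hU', rfl⟩
      exact (h3 U hU).inter (k3 U' hU')
    · rintro _ ⟨U, hU, U', hU', rfl⟩ ⟨x, y⟩ ⟨hx, hy⟩
      exact ⟨h4 U hU ⟨hx.1, hy.1⟩, k4 U' hU' ⟨hx.2, hy.2⟩⟩

/-- Small star-finite covers pull back. Since they are packaged as a filter, having a star-finite
base thus passes to initial uniformities, in particular to products and subspaces. -/
theorem tendsto_starFiniteFilter {X Y : Type*} [UniformSpace X] [UniformSpace Y]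
    {f : X → Y} (hf : UniformContinuous f) (hY : starFiniteFilter Y ≤ 𝓤 Y) :
    Tendsto (Prod.map f f) (starFiniteFilter X) (𝓤 Y) := by
  intro V hV
  obtain ⟨B, ⟨W, hW, hWB⟩, h2, h3, h4⟩ := hY hV
  refine ⟨(f ⁻¹' ·) '' B, ⟨_, hf hW, fun x => ?_⟩, h2.preimage f, ?_, ?_⟩
  · obtain ⟨U, hU, hWU⟩ := hWB (f x)
    exact ⟨_, mem_image_of_mem _ hU, fun y hy => hWU hy⟩
  · rintro _ ⟨U, hU, rfl⟩
    exact (h3 U hU).preimage hf.continuous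
  · rintro _ ⟨U, hU, rfl⟩ ⟨x, y⟩ ⟨hx, hy⟩
    exact h4 U hU ⟨hx, hy⟩

theorem starFiniteFilter_le_of_discreteUniformity (D : Type*) [UniformSpace D]
    [DiscreteUniformity D] : starFiniteFilter D ≤ 𝓤 D := by
  intro V hV
  refine ⟨range singleton, ⟨SetRel.id, ?_, fun x => ⟨{x}, mem_range_self x, fun y hy => ?_⟩⟩,
    ?_, ?_, ?_⟩
  · rw [DiscreteUniformity.eq_principal_setRelId]
    exact mem_principal_self _
  · exact (show x = y from hy).symm
  · rintro _ ⟨x, rfl⟩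
    refine (finite_singleton {x}).subset ?_
    rintro _ ⟨⟨y, rfl⟩, z, hzx, hzy⟩
    rw [mem_singleton_iff] at hzx hzy ⊢
    rw [← hzx, ← hzy]
  · simp
  · rintro _ ⟨x, rfl⟩ ⟨y, z⟩ ⟨hy, hz⟩
    obtain rfl : y = x := hy
    obtain rfl : z = y := hz
    exact refl_mem_uniformity hV

theorem starFiniteFilter_real_le : starFiniteFilter ℝ ≤ 𝓤 ℝ := by
  intro V hV
  obtain ⟨ε, hε, hV⟩ := Metric.mem_uniformity_dist.1 hV
  obtain ⟨δ, hδ, rfl⟩ : ∃ δ > 0, ε = 2 * δ := ⟨ε / 2, half_pos hε, by ring⟩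
  -- Each interval has length `2δ = ε`. The index `k = ⌊x/δ - 1/2⌋` satisfies `kδ ≤ x - δ/2 <
  -- (k+1)δ`, so the `δ/2`-ball about `x` fits inside.
  refine ⟨range fun k : ℤ => Ioo (k * δ) ((k + 2) * δ), ⟨_, Metric.dist_mem_uniformity
    (half_pos hδ), fun x => ⟨_, mem_range_self ⌊x / δ - 1 / 2⌋, fun y hy => ?_⟩⟩, ?_, ?_, ?_⟩
  · have hy : dist x y < δ / 2 := hy
    rw [Real.dist_eq, abs_lt] at hy
    have h1 := mul_le_mul_of_nonneg_right (Int.floor_le (x / δ - 1 / 2)) hδ.le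
    have h2 := mul_lt_mul_of_pos_right (Int.lt_floor_add_one (x / δ - 1 / 2)) hδ
    have h3 : (x / δ - 1 / 2) * δ = x - δ / 2 := by field_simp
    constructor <;> linarith
  · rintro _ ⟨k, rfl⟩
    refine ((finite_Icc (k - 2) (k + 2)).image
      fun k : ℤ => Ioo (k * δ) ((k + 2) * δ)).subset ?_
    rintro _ ⟨⟨l, rfl⟩, x, hx, hx'⟩
    have h1 : (k : ℝ) < l + 2 := lt_of_mul_lt_mul_right (hx.1.trans hx'.2) hδ.le
    have h2 : (l : ℝ) < k + 2 := lt_of_mul_lt_mul_right (hx'.1.trans hx.2) hδ.le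
    have h1 : k < l + 2 := by exact_mod_cast h1
    have h2 : l < k + 2 := by exact_mod_cast h2
    exact ⟨l, ⟨by omega, by omega⟩, rfl⟩
  · rintro _ ⟨k, rfl⟩
    exact isOpen_Ioo
  · rintro _ ⟨k, rfl⟩ ⟨x, y⟩ ⟨hx, hy⟩
    refine hV ?_
    rw [Real.dist_eq, abs_lt]
    constructor <;> linarith [hx.1, hx.2, hy.1, hy.2]

theorem starFiniteFilter_pi_le {ι : Type*} {Y : ι → Type*} [∀ i, UniformSpace (Y i)]
    (h : ∀ i, starFiniteFilter (Y i) ≤ 𝓤 (Y i)) :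
    starFiniteFilter (∀ i, Y i) ≤ 𝓤 (∀ i, Y i) := by
  rw [Pi.uniformity]
  exact le_iInf fun i => tendsto_iff_comap.1
    (tendsto_starFiniteFilter (Pi.uniformContinuous_proj Y i) (h i))

theorem starFiniteFilter_prod_le {Y Z : Type*} [UniformSpace Y] [UniformSpace Z]
    (hY : starFiniteFilter Y ≤ 𝓤 Y) (hZ : starFiniteFilter Z ≤ 𝓤 Z) :
    starFiniteFilter (Y × Z) ≤ 𝓤 (Y × Z) := by
  rw [uniformity_prod]
  exact le_inf (tendsto_iff_comap.1 (tendsto_starFiniteFilter uniformContinuous_fst hY))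
    (tendsto_iff_comap.1 (tendsto_starFiniteFilter uniformContinuous_snd hZ))

theorem IsUniformInducing.starFiniteFilter_le {X Y : Type*} [UniformSpace X] [UniformSpace Y]
    {f : X → Y} (hf : IsUniformInducing f) (hY : starFiniteFilter Y ≤ 𝓤 Y) :
    starFiniteFilter X ≤ 𝓤 X := by
  rw [← hf.comap_uniformity]
  exact tendsto_iff_comap.1 (tendsto_starFiniteFilter hf.uniformContinuous hY)

theorem uniformCovers_eq_starFiniteModification {X : Type u} [UniformSpace X]
    (h : starFiniteFilter X ≤ 𝓤 X) : uniformCovers X = starFiniteModification X := by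
  refine Subset.antisymm ?_ fun C ⟨B, hB, _, _, hBC⟩ => mem_uniformCovers_of_refines hB hBC
  rintro C ⟨V, hV, hVC⟩
  obtain ⟨B, ⟨W, hW, hWB⟩, h2, h3, h4⟩ := h hV
  -- A point of `U` is needed to find the member of `C` around it, so the empty set is discarded.
  refine ⟨B \ {∅}, ⟨W, hW, fun x => ?_⟩, fun U hU => ?_, fun U hU => h3 U hU.1, fun U hU => ?_⟩
  · obtain ⟨U, hU, hxU⟩ := hWB x
    exact ⟨U, ⟨hU, Nonempty.ne_empty ⟨x, hxU (UniformSpace.mem_ball_self x hW)⟩⟩, hxU⟩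
  · exact (h2 U hU.1).subset fun V hV => ⟨hV.1.1, hV.2⟩
  · obtain ⟨x, hx⟩ := nonempty_iff_ne_empty.2 hU.2
    obtain ⟨O, hO, hVO⟩ := hVC x
    exact ⟨O, hO, fun y hy => hVO (h4 U hU.1 ⟨hx, hy⟩)⟩

theorem starFiniteModification_subset_starCountableModification (X : Type u) [UniformSpace X] :
    starFiniteModification X ⊆ starCountableModification X :=
  fun _ ⟨B, hB, hBs, _, hBC⟩ => ⟨B, hB, fun U hU => (hBs U hU).countable, hBC⟩

theorem starCountableModification_subset_uniformCovers (X : Type u) [UniformSpace X] :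
    starCountableModification X ⊆ uniformCovers X :=
  fun _ ⟨_, hB, _, hBC⟩ => mem_uniformCovers_of_refines hB hBC

theorem exists_completeSpace_starFinite_of_isClosedEmbedding {X D : Type u} [t : TopologicalSpace X]
    [T0Space X] [tD : TopologicalSpace D] [DiscreteTopology D] {f : X → (ℕ → D) × (ℕ → ℝ)}
    (hf : IsClosedEmbedding f) : ∃ d : MetricSpace X, IsCompatibleMetric d ∧
      @CompleteSpace X d.toUniformSpace ∧
      @uniformCovers X d.toUniformSpace = @starFiniteModification X d.toUniformSpace := by
  obtain rfl : tD = ⊥ := DiscreteTopology.eq_bot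
  let uD : UniformSpace D := ⊥
  have : DiscreteUniformity D := ⟨rfl⟩
  let uX : UniformSpace X := (UniformSpace.comap f inferInstance).replaceTopology hf.eq_induced
  have hfu : IsUniformInducing f := ⟨rfl⟩
  have : (𝓤 D).IsCountablyGenerated := by
    rw [DiscreteUniformity.eq_principal_setRelId]
    infer_instance
  have : (𝓤 X).IsCountablyGenerated := by
    rw [← hfu.comap_uniformity]
    infer_instance
  refine ⟨UniformSpace.metricSpace X, rfl,
    hfu.completeSpace hf.isClosed_range.isComplete, ?_⟩
  refine uniformCovers_eq_starFiniteModification (hfu.starFiniteFilter_le ?_)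
  exact starFiniteFilter_prod_le
    (starFiniteFilter_pi_le fun _ => starFiniteFilter_le_of_discreteUniformity D)
    (starFiniteFilter_pi_le fun _ => starFiniteFilter_real_le)

/-! ### Embedding strongly metrizable spaces -/

theorem IsStarFiniteOpenCover.locallyFinite {X : Type u} [TopologicalSpace X] {C : Set (Set X)}
    (hC : IsStarFiniteOpenCover C) : LocallyFinite fun U : C => (U : Set X) := by
  intro x
  obtain ⟨U, hU, hxU⟩ := hC.1.exists_mem x
  refine ⟨U, (hC.2.2 U hU).mem_nhds hxU,
    ((hC.2.1 U hU).preimage Subtype.val_injective.injOn).subset ?_⟩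
  rintro V ⟨y, hyV, hyU⟩
  exact ⟨V.2, y, hyU, hyV⟩

/-- The union of the members of `C` whose closure lies in `O`. -/
def coverInner {X : Type u} [TopologicalSpace X] (C : Set (Set X)) (O : Set X) : Set X :=
  ⋃₀ {W ∈ C | closure W ⊆ O}

/-- Star-finite open covers are locally finite, so closure commutes with the union. -/
theorem IsStarFiniteOpenCover.closure_coverInner_subset {X : Type u} [TopologicalSpace X]
    {C : Set (Set X)} (hC : IsStarFiniteOpenCover C) (O : Set X) :
    closure (coverInner C O) ⊆ O := by
  have : LocallyFinite fun W : {W ∈ C | closure W ⊆ O} => (W : Set X) :=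
    hC.locallyFinite.comp_injective (g := fun W : {W ∈ C | closure W ⊆ O} => (⟨W.1, W.2.1⟩ : C))
      fun V W h => Subtype.ext (congrArg (fun U : C => (U : Set X)) h)
  rw [coverInner, sUnion_eq_iUnion, this.closure_iUnion]
  exact iUnion_subset fun W => W.2.2

theorem exists_mem_coverInner {X : Type u} [TopologicalSpace X] [RegularSpace X]
    {V : ℕ → Set (Set X)} (hb : TopologicalSpace.IsTopologicalBasis (⋃ n, V n)) {O : Set X}
    (hO : IsOpen O) {x : X} (hx : x ∈ O) : ∃ n, x ∈ coverInner (V n) O := by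
  obtain ⟨K, hK, hKc, hKO⟩ := exists_mem_nhds_isClosed_subset (hO.mem_nhds hx)
  obtain ⟨W, hW, hxW, hWK⟩ := hb.mem_nhds_iff.1 hK
  obtain ⟨n, hn⟩ := mem_iUnion.1 hW
  exact ⟨n, W, ⟨hn, (closure_minimal hWK hKc).trans hKO⟩, hxW⟩

/-- The argument for regular Lindelöf spaces applies: countably many open sets with closures missing
`t` cover `s`, and conversely. -/
theorem normalSpace_of_isStarFiniteOpenCover {X : Type u} [TopologicalSpace X] [RegularSpace X]
    {V : ℕ → Set (Set X)} (hV : ∀ n, IsStarFiniteOpenCover (V n))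
    (hb : TopologicalSpace.IsTopologicalBasis (⋃ n, V n)) : NormalSpace X := by
  have key (s t : Set X) (ht : IsClosed t) (hst : Disjoint s t) : HasSeparatingCover s t := by
    refine ⟨fun n => coverInner (V n) tᶜ, fun x hx => ?_, fun n =>
      ⟨isOpen_sUnion fun W hW => (hV n).2.2 W hW.1, ?_⟩⟩
    · exact mem_iUnion.2 (exists_mem_coverInner hb ht.isOpen_compl (hst.notMem_of_mem_left hx))
    · exact disjoint_left.2 fun x hx => (hV n).closure_coverInner_subset tᶜ hx
  exact ⟨fun s t hs ht hst => hasSeparatingCovers_iff_separatedNhds.1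
    ⟨key s t ht hst, key t s hs hst.symm⟩⟩

theorem mk_connectedComponent_le_cellularity {X : Type u} [TopologicalSpace X] {C : Set (Set X)}
    (hC : IsCover C) (ho : ∀ U ∈ C, IsOpen U) :
    #(coverGraph C).ConnectedComponent ≤ cellularity X := by
  let F (c : (coverGraph C).ConnectedComponent) : Set X :=
    {x | (coverGraph C).connectedComponentMk x = c}
  have hF : Function.Injective F := by
    intro c d h
    obtain ⟨x, rfl⟩ := c.exists_rep
    exact (h ▸ (rfl : x ∈ F _) : x ∈ F d)
  have hP : Setoid.IsPartition (range F) := by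
    refine ⟨?_, fun x => ⟨F _, ⟨mem_range_self _, rfl⟩, ?_⟩⟩
    · rintro ⟨c, hc⟩
      obtain ⟨x, rfl⟩ := c.exists_rep
      exact (hc ▸ (rfl : x ∈ F _) : x ∈ (∅ : Set X))
    · rintro _ ⟨⟨c, rfl⟩, hx⟩
      exact congrArg F hx.symm
  rw [← Cardinal.mk_range_eq F hF]
  exact le_ciSup (f := fun P : {P : Set (Set X) // Setoid.IsPartition P ∧ ∀ U ∈ P, IsOpen U} =>
    #(P : Set (Set X))) (Cardinal.bddAbove_of_small) ⟨range F, hP, by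
      rintro _ ⟨c, rfl⟩
      exact isOpen_coverGraph_component hC ho c⟩

/-- A strongly metrizable space embeds in `D^ω × ℝ^ω`, where the cardinality of `D` is the
cellularity. -/
theorem IsStronglyMetrizable.exists_isInducing {X D : Type u} [TopologicalSpace X] [RegularSpace X]
    [TopologicalSpace D] [DiscreteTopology D] (hD : #D = cellularity X)
    (h : IsStronglyMetrizable X) : ∃ e : X → (ℕ → D) × (ℕ × ℕ × ℕ → ℝ), IsInducing e := by
  obtain ⟨V, hV, hb⟩ := h
  have hV (n) : IsStarFiniteOpenCover (V n) := hV n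
  have := normalSpace_of_isStarFiniteOpenCover hV hb
  let c (n : ℕ) (x : X) := (coverGraph (V n)).connectedComponentMk x
  have hcopen (n : ℕ) (x : X) : ∀ᶠ y in 𝓝 x, c n y = c n x :=
    (isOpen_coverGraph_component (hV n).1 (hV n).2.2 (c n x)).mem_nhds rfl
  have (n : ℕ) : Nonempty ((coverGraph (V n)).ConnectedComponent ↪ D) := by
    rw [← Cardinal.le_def, hD]
    exact mk_connectedComponent_le_cellularity (hV n).1 (hV n).2.2
  let i (n : ℕ) := (this n).some
  have hu (U : Set X) (n m : ℕ) (hU : U ∈ V n) : ∃ φ : C(X, ℝ), EqOn φ 0 Uᶜ ∧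
      EqOn φ 1 (closure (coverInner (V m) U)) := by
    obtain ⟨φ, h0, h1, -⟩ := exists_continuous_zero_one_of_isClosed
      ((hV n).2.2 U hU).isClosed_compl isClosed_closure
      (disjoint_left.2 fun x hx hx' => hx ((hV m).closure_coverInner_subset U hx'))
    exact ⟨φ, h0, h1⟩
  choose! φ hφ0 hφ1 using hu
  have hen (n : ℕ) (d : (coverGraph (V n)).ConnectedComponent) : ∃ f : ℕ → Set X, range f =
      {U ∈ V n | ∃ x ∈ U, (coverGraph (V n)).connectedComponentMk x = d} := by
    obtain ⟨x, rfl⟩ := d.exists_rep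
    obtain ⟨U, hU, hxU⟩ := (hV n).1.exists_mem x
    have hs : IsStarCountable (V n) := fun U hU => ((hV n).2.1 U hU).countable
    obtain ⟨f, hf⟩ := (hs.countable_component (hV n).1
      ((coverGraph (V n)).connectedComponentMk x)).exists_eq_range ⟨U, hU, x, hxU, rfl⟩
    exact ⟨f, hf.symm⟩
  choose f hf using hen
  -- Coordinate `(n, k, m)` evaluates the Urysohn function of the `k`-th member in the component of
  -- `x`. The choice of function depends on `x` but is locally constant, so the coordinate is
  -- continuous.
  let e (x : X) : (ℕ → D) × (ℕ × ℕ × ℕ → ℝ) :=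
    (fun n => i n (c n x), fun p => φ (f p.1 (c p.1 x) p.2.1) p.1 p.2.2 x)
  have he : Continuous e := by
    refine (continuous_pi fun n => ?_).prodMk (continuous_pi fun p => ?_)
    · exact continuous_iff_continuousAt.2 fun x => (continuousAt_const (y := i n (c n x))).congr
        ((hcopen n x).mono fun y hy => by simp only [hy])
    · exact continuous_iff_continuousAt.2 fun x =>
        (φ (f p.1 (c p.1 x) p.2.1) p.1 p.2.2).continuous.continuousAt.congr
          ((hcopen p.1 x).mono fun y hy => by simp only [hy])
  refine ⟨e, isInducing_iff_nhds.2 fun x => le_antisymm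
    (tendsto_iff_comap.1 he.continuousAt) fun O hO => ?_⟩
  obtain ⟨U, hU, hxU, hUO⟩ := hb.mem_nhds_iff.1 hO
  obtain ⟨n, hn⟩ := mem_iUnion.1 hU
  obtain ⟨m, hm⟩ := exists_mem_coverInner hb ((hV n).2.2 U hn) hxU
  obtain ⟨k, hk⟩ : U ∈ range (f n (c n x)) := by
    rw [hf]
    exact ⟨hn, x, hxU, rfl⟩
  have hx1 : (e x).2 (n, k, m) = 1 := by
    simp only [e, hk]
    exact hφ1 U n m hn (subset_closure hm)
  -- The first condition puts `y` in the component of `x`, where the `k`-th member is again `U`;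
  -- positivity then puts `y` in `U`.
  refine mem_comap.2 ⟨{q | q.1 n = (e x).1 n} ∩ {q | 0 < q.2 (n, k, m)}, inter_mem ?_ ?_, ?_⟩
  · have hc : Continuous fun q : (ℕ → D) × (ℕ × ℕ × ℕ → ℝ) => q.1 n := by fun_prop
    exact ((isOpen_discrete {(e x).1 n}).preimage hc).mem_nhds rfl
  · refine (isOpen_Ioi.preimage
      ((continuous_apply (n, k, m)).comp continuous_snd)).mem_nhds ?_
    simp [hx1]
  · rintro y ⟨hy, hy'⟩
    have hy : c n y = c n x := (i n).injective hy
    by_contra hyO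
    have : (e y).2 (n, k, m) = 0 := by
      simp only [e, hy, hk]
      exact hφ0 U n m hn fun h => hyO (hUO h)
    rw [mem_ofPred_eq, this] at hy'
    exact lt_irrefl _ hy'

/-- If a Čech-complete space embeds in a metrizable space `Y`, then it embeds as a closed subspace
in `Y × ℝ^ω`. -/
theorem IsCechComplete.exists_isClosedEmbedding {X Y : Type*} [TopologicalSpace X] [T35Space X]
    [TopologicalSpace Y] [TopologicalSpace.MetrizableSpace Y] (h : IsCechComplete X) {e : X → Y}
    (he : IsInducing e) : ∃ g : X → ℕ → ℝ, IsClosedEmbedding fun x => (e x, g x) := by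
  obtain ⟨V, hV⟩ := h.exists_isCompleteFamily
  let O (n : ℕ) : Set Y := ⋃₀ {W | IsOpen W ∧ ∃ U ∈ V n, e ⁻¹' W ⊆ U}
  have hO (n) : IsOpen (O n) := isOpen_sUnion fun W hW => hW.1
  have heO (x n) : e x ∈ O n := by
    obtain ⟨U, hU, hxU⟩ := (hV.1 n).1.exists_mem x
    obtain ⟨W, hW, rfl⟩ := he.isOpen_iff.1 ((hV.1 n).2 U hU)
    exact ⟨W, ⟨hW, _, hU, Subset.rfl⟩, hxU⟩
  let _ := TopologicalSpace.metrizableSpaceMetric Y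
  have (n : ℕ) : ∃ φ : C(Y, ℝ), (O n)ᶜ = φ ⁻¹' {0} := by
    obtain ⟨φ, hφ, -⟩ := perfectlyNormalSpace_iff_forall_isClosed_preimage_zero.1
      (inferInstanceAs (PerfectlyNormalSpace Y)) _ (hO n).isClosed_compl
    exact ⟨φ, hφ⟩
  choose φ hφ using this
  have hφe (x n) : φ n (e x) ≠ 0 := fun h => by
    have : e x ∈ (O n)ᶜ := hφ n ▸ h
    exact this (heO x n)
  let g (x : X) (n : ℕ) : ℝ := (φ n (e x))⁻¹
  have hg : Continuous g := continuous_pi fun n =>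
    ((φ n).continuous.comp he.continuous).inv₀ fun x => hφe x n
  have hE : Continuous fun x => (e x, g x) := he.continuous.prodMk hg
  have hind : IsInducing fun x => (e x, g x) :=
    IsInducing.of_comp hE continuous_fst he
  refine ⟨g, ⟨hind.isEmbedding, isClosed_of_closure_subset fun p hp => ?_⟩⟩
  have := comap_neBot_iff_frequently.2 (mem_closure_iff_frequently.1 hp)
  let u := Ultrafilter.of (comap (fun x => (e x, g x)) (𝓝 p))
  have hu : Tendsto (fun x => (e x, g x)) u (𝓝 p) := tendsto_iff_comap.2 (Ultrafilter.of_le _)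
  have hu1 : Tendsto e u (𝓝 p.1) := (continuous_fst.tendsto p).comp hu
  have hu2 (n) : Tendsto (fun x => g x n) u (𝓝 (p.2 n)) :=
    (((continuous_apply n).comp continuous_snd).tendsto p).comp hu
  have hpO (n) : p.1 ∈ O n := by
    by_contra hcon
    have h0 : φ n p.1 = 0 := by
      have : p.1 ∈ (O n)ᶜ := hcon
      rw [hφ] at this
      exact this
    -- The product of `φ n ∘ e` with its reciprocal is constantly 1, yet would tend to 0 if `p.1`
    -- were outside `O n`.
    have h1 := (((φ n).continuous.tendsto p.1).comp hu1).mul (hu2 n)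
    rw [h0, zero_mul] at h1
    have h2 : Tendsto (fun _ : X => (1 : ℝ)) u (𝓝 0) :=
      h1.congr fun x => mul_inv_cancel₀ (hφe x n)
    exact one_ne_zero (tendsto_nhds_unique tendsto_const_nhds h2)
  obtain ⟨x, hx⟩ := hV.2 u fun n => by
    obtain ⟨W, ⟨hW, U, hU, hWU⟩, hpW⟩ := hpO n
    exact ⟨U, hU, mem_of_superset (hu1 (hW.mem_nhds hpW)) hWU⟩
  exact ⟨x, tendsto_nhds_unique ((hE.tendsto x).mono_left hx) hu⟩

theorem exists_isClosedEmbedding_of_isCechComplete {X D : Type u} [TopologicalSpace X] [T35Space X]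
    [TopologicalSpace D] [DiscreteTopology D] (hD : #D = cellularity X)
    (hc : IsCechComplete X) (h : IsStronglyMetrizable X) :
    ∃ f : X → (ℕ → D) × (ℕ → ℝ), IsClosedEmbedding f := by
  obtain ⟨e, he⟩ := h.exists_isInducing hD
  obtain ⟨g, hg⟩ := hc.exists_isClosedEmbedding he
  obtain ⟨r⟩ : Nonempty ((ℕ × ℕ × ℕ) ⊕ ℕ ≃ ℕ) := ⟨Denumerable.eqv _⟩
  let k : ((ℕ → D) × (ℕ × ℕ × ℕ → ℝ)) × (ℕ → ℝ) ≃ₜ (ℕ → D) × (ℕ → ℝ) :=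
    (Homeomorph.prodAssoc _ _ _).trans ((Homeomorph.refl _).prodCongr
      (Homeomorph.sumArrowHomeomorphProdArrow.symm.trans
        (Homeomorph.piCongrLeft (Y := fun _ => ℝ) r)))
  exact ⟨_, k.isClosedEmbedding.comp hg⟩

/-! ### The equivalence of the six conditions -/

theorem mainTheorem4 (X : Type u) [TopologicalSpace X] [T35Space X] :
    List.TFAE [
      (∃ d : MetricSpace X, IsCompatibleMetric d ∧
        @IsBourbakiComplete X d.toUniformSpace),
      (∃ d : MetricSpace X, IsCompatibleMetric d ∧
        @CompleteSpace X d.toUniformSpace ∧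
        @uniformCovers X d.toUniformSpace = @starFiniteModification X d.toUniformSpace),
      (∃ (D : Type u) (_ : TopologicalSpace D), DiscreteTopology D ∧ #D = cellularity X ∧
        HomeomorphicToClosedSubspace X ((ℕ → D) × (ℕ → ℝ))),
      (∃ (ι : Type) (Y : ι → Type u) (_ : ∀ i, MetricSpace (Y i)), Countable ι ∧
        (∀ i, LocallyCompactSpace (Y i)) ∧
        HomeomorphicToClosedSubspace X (∀ i, Y i)),
      (IsCechComplete X ∧ IsStronglyMetrizable X),
      (∃ d : MetricSpace X, IsCompatibleMetric d ∧
        @CompleteSpace X d.toUniformSpace ∧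
        @uniformCovers X d.toUniformSpace = @starCountableModification X d.toUniformSpace)] := by
  tfae_have 1 → 5 := by
    rintro ⟨d, rfl, h⟩
    exact ⟨isCechComplete_of_isBourbakiComplete h, isStronglyMetrizable_of_isBourbakiComplete h⟩
  tfae_have 2 → 1 := by
    rintro ⟨d, hd, hc, h⟩
    exact ⟨d, hd, isBourbakiComplete_of_starFinite h⟩
  tfae_have 2 → 6 := by
    rintro ⟨d, hd, hc, h⟩
    refine ⟨d, hd, hc, Subset.antisymm ?_ (starCountableModification_subset_uniformCovers X)⟩
    rw [h]
    exact starFiniteModification_subset_starCountableModification X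
  tfae_have 6 → 5 := by
    rintro ⟨d, rfl, hc, h⟩
    exact ⟨isCechComplete_of_completeSpace, isStronglyMetrizable_of_starCountable h⟩
  tfae_have 5 → 3 := by
    rintro ⟨hc, h⟩
    let _ : TopologicalSpace (cellularity X).out := ⊥
    have : DiscreteTopology (cellularity X).out := ⟨rfl⟩
    obtain ⟨f, hf⟩ := exists_isClosedEmbedding_of_isCechComplete (Cardinal.mk_out _) hc h
    exact ⟨(cellularity X).out, ⊥, ⟨rfl⟩, Cardinal.mk_out _, hf.homeomorphicToClosedSubspace⟩
  tfae_have 3 → 4 := by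
    rintro ⟨D, _, _, -, h⟩
    obtain ⟨f, hf⟩ := h.exists_isClosedEmbedding
    let _ : MetricSpace D := TopologicalSpace.metrizableSpaceMetric D
    exact ⟨ℕ, fun _ => D × ULift.{u} ℝ, inferInstance, inferInstance, inferInstance,
      hf.homeomorphicToClosedSubspace_pi⟩
  tfae_have 4 → 5 := by
    rintro ⟨ι, Y, _, _, _, h⟩
    obtain ⟨f, hf⟩ := h.exists_isClosedEmbedding
    exact isCechComplete_and_isStronglyMetrizable_of_isClosedEmbedding hf
  tfae_have 3 → 2 := by
    rintro ⟨D, _, _, -, h⟩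
    obtain ⟨f, hf⟩ := h.exists_isClosedEmbedding
    exact exists_completeSpace_starFinite_of_isClosedEmbedding hf
  tfae_finish
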